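/- A locally finite weighted graph is a triple $G=(V,w,m)$ with $V$ a countable set, $w:V^2\to[0,\infty)$ symmetric and zero on the diagonal, $m:V\to(0,\infty)$, and such that for every $x\in V$ only finitely many $y\in V$ satisfy $w(x,y)>0$. Write $x\sim y$ if $w(x,y)>0$, and let $d$ be the combinatorial graph distance. All graphs are assumed connected. Put $\Delta f(x)=\frac1{m(x)}\sum_{y}w(x,y)(f(y)-f(x))$. For $x\neq y$ the Ollivier curvature is $$\kappa(x,y)=\lim_{\varepsilon\to0^+}\frac1\varepsilon\Bigl(1-\frac{W(m_x^\varepsilon,m_y^\varepsilon)}{d(x,y)}\Bigr),\qquad m_x^\varepsilon(z)=1_z(x)+\varepsilon\,\Delta 1_z(x),$$ where $W(\mu,\nu)=\sup_f\sum_{z}f(z)(\mu(z)-\nu(z))$, the supremum being taken over all bounded $f:V\to\mathbb R$ with $|f(x)-f(y)|\le d(x,y)$ for all $x,y$. For a root $x_0\in V$ and $S_r=\{y:d(x_0,y)=r\}$, the sphere curvatures are $$\kappa(r)=\min_{y\in S_r}\ \max_{x\in S_{r-1},\,x\sim y}\kappa(x,y),\qquad r\ge1,$$ with the convention $\min\emptyset=+\infty$.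 The graph is called stochastically complete (non-explosive) if $P_t\mathbf 1=\mathbf 1$ for all $t>0$, where $P_t\mathbf 1$ is the smallest non-negative bounded continuous solution $u$ of $\partial_t u=\Delta u$ on $[0,\infty)\times V$ with $u(0,\cdot)=\mathbf 1$; otherwise it is called stochastically incomplete. **Theorem 4.10 (Stochastic completeness).** (i) Let $G=(V,w,m)$ be a connected locally finite weighted graph and $x_0\in V$. If there is a constant $C>0$ with $\kappa(r)\ge -C\log r$ for all sufficiently large $r$, then $G$ is stochastically complete. (ii) For $\varepsilon>0$ let $G_\varepsilon=(\mathbb N_0,w,m)$ be the birth–death chain (that is, $w(i,j)=0$ whenever $|i-j|\ne1$) with $m\equiv1$ and $$w(R,R+1)=1+\sum_{r=1}^{R}\sum_{k=1}^{r}(\log k)^{1+\varepsilon},\qquad R\ge0.$$ Then $G_\varepsilon$ is a connected graph, it is stochastically incomplete, and its sphere curvatures with respect to $x_0=0$ satisfy $\kappa(r)\ge-(\log r)^{1+\varepsilon}$ for all $r\ge2$. -/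

import Mathlib

open Filter Topology

/-- A locally finite weighted graph `(V, w, m)`: the edge weight `w` is symmetric, non-negative and
zero on the diagonal, the vertex measure `m` is positive, and every vertex has only finitely many
neighbours. -/
structure WeightedGraph (V : Type*) where
  w : V → V → ℝ
  m : V → ℝ
  w_nonneg : ∀ x y, 0 ≤ w x y
  w_symm : ∀ x y, w x y = w y x
  w_self : ∀ x, w x x = 0
  m_pos : ∀ x, 0 < m x
  locallyFinite : ∀ x, {y | 0 < w x y}.Finite

namespace WeightedGraph

variable {V : Type*} (G : WeightedGraph V)

/-- The underlying simple graph: `x ∼ y` if and only if `w x y > 0`. -/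
def toSimpleGraph : SimpleGraph V where
  Adj x y := 0 < G.w x y
  symm := ⟨fun x y h => by rw [G.w_symm y x]; exact h⟩
  loopless := ⟨fun x h => by rw [G.w_self x] at h; exact lt_irrefl 0 h⟩

/-- The combinatorial graph distance (meaningful when `G.toSimpleGraph` is connected). -/
noncomputable def dist (x y : V) : ℕ := G.toSimpleGraph.dist x y

/-- The graph Laplacian `Δ f (x) = (1 / m x) ∑ y, w x y (f y - f x)`; the sum has only finitely
many non-zero terms. -/
noncomputable def laplacian (f : V → ℝ) (x : V) : ℝ :=
  1 / G.m x * ∑' y, G.w x y * (f y - f x)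

/-- `f ∈ Lip(1)` with respect to the combinatorial graph distance. -/
def IsLip1 (f : V → ℝ) : Prop := ∀ x y, |f x - f y| ≤ (G.dist x y : ℝ)

/-- The Wasserstein distance `sup { ∑ z, f z (μ z - ν z) | f bounded and 1-Lipschitz }` of two
probability measures on `V`, given by their weights. -/
noncomputable def wasserstein (μ ν : V → ℝ) : ℝ :=
  sSup {a | ∃ f : V → ℝ, G.IsLip1 f ∧ (∃ C, ∀ x, |f x| ≤ C) ∧ a = ∑' z, f z * (μ z - ν z)}

open Classical in
/-- The weights `m_x^ε (y) = 1_y (x) + ε Δ 1_y (x)`; for small `ε > 0` this is a finitely supported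
probability measure. -/
noncomputable def stepMeasure (ε : ℝ) (x y : V) : ℝ :=
  Pi.single (M := fun _ => ℝ) y 1 x + ε * G.laplacian (Pi.single (M := fun _ => ℝ) y 1) x

/-- `κ_ε (x, y) = 1 - W(m_x^ε, m_y^ε) / d(x, y)`, for `x ≠ y`. -/
noncomputable def curvatureStep (ε : ℝ) (x y : V) : ℝ :=
  1 - G.wasserstein (G.stepMeasure ε x) (G.stepMeasure ε y) / (G.dist x y : ℝ)

/-- The Ollivier curvature `κ(x, y) = lim_{ε → 0+} κ_ε (x, y) / ε`, for `x ≠ y`. (On a connected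
graph the limit exists, because `ε ↦ W(m_x^ε, m_y^ε)` is a real-valued supremum of affine functions of
`ε`, hence convex, with value `d(x, y)` at `ε = 0`.) -/
noncomputable def curvature (x y : V) : ℝ :=
  limUnder (𝓝[>] (0 : ℝ)) (fun ε => 1 / ε * G.curvatureStep ε x y)

/-- The sphere curvatures `κ(r) = min_{y ∈ S_r} max_{x ∈ S_{r-1}, x ∼ y} κ(x, y)` with respect to
the root `x₀`, for `r ≥ 1`. On a connected graph all the index sets are finite; the value is a real
number when `S_r` is non-empty, and `⊤` (the minimum over the empty set) when `S_r` is empty, which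
happens only for finite graphs. -/
noncomputable def sphereCurvature (x₀ : V) (r : ℕ) : EReal :=
  ⨅ y ∈ {y | G.dist x₀ y = r}, ⨆ x ∈ {x | G.dist x₀ x + 1 = r ∧ G.toSimpleGraph.Adj x y},
    ((G.curvature x y : ℝ) : EReal)

/-- `u : [0, ∞) × V → ℝ` is a non-negative bounded continuous solution of the heat equation
`∂ₜ u = Δ u` with initial value `f`. The time derivative at `t = 0` is one-sided; only the values
`u t` with `t ≥ 0` matter. -/
structure IsHeatSolution (f : V → ℝ) (u : ℝ → V → ℝ) : Prop where
  nonneg : ∀ t, 0 ≤ t → ∀ x, 0 ≤ u t x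
  bounded : ∃ C, ∀ t, 0 ≤ t → ∀ x, u t x ≤ C
  continuousOn : ∀ x, ContinuousOn (fun t => u t x) (Set.Ici 0)
  heat : ∀ t, 0 ≤ t → ∀ x,
    HasDerivWithinAt (fun s => u s x) (G.laplacian (u t) x) (Set.Ici 0) t
  initial : ∀ x, u 0 x = f x

/-- `u t x = P_t f (x)` for `t ≥ 0`: the smallest non-negative bounded continuous solution of the
heat equation with initial value `f`. -/
def IsHeatSemigroup (f : V → ℝ) (u : ℝ → V → ℝ) : Prop :=
  G.IsHeatSolution f u ∧
    ∀ v, G.IsHeatSolution f v → ∀ t, 0 ≤ t → ∀ x, u t x ≤ v t x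

/-- Stochastic completeness (non-explosion): `P_t 1 = 1` for all `t > 0`. -/
def StochasticallyComplete : Prop :=
  ∃ u, G.IsHeatSemigroup (fun _ => 1) u ∧ ∀ t, 0 < t → ∀ x, u t x = 1

/-- The birth-death chain on `ℕ = {0, 1, 2, …}` with vertex measure `m` and edge weights
`w (n, n+1) = b n`; all weights between vertices that are not consecutive are zero. -/
noncomputable def birthDeathChain (b m : ℕ → ℝ) (hb : ∀ n, 0 ≤ b n) (hm : ∀ n, 0 < m n) :
    WeightedGraph ℕ where
  w i j := if j = i + 1 then b i else if i = j + 1 then b j else 0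
  m := m
  w_nonneg i j := by
    split_ifs
    · exact hb i
    · exact hb j
    · exact le_rfl
  w_symm i j := by
    split_ifs <;> first | rfl | omega
  w_self i := by simp
  m_pos := hm
  locallyFinite i := by
    refine (Set.finite_le_nat (i + 1)).subset fun j hj => ?_
    simp only [Set.mem_ofPred_eq] at hj ⊢
    by_contra hlt
    rw [if_neg (by omega), if_neg (by omega)] at hj
    exact lt_irrefl 0 hj

/-- The weights `w (R, R+1) = 1 + ∑_{r=1}^R ∑_{k=1}^r (log k)^{1+ε}`. -/
noncomputable def logWeight (ε : ℝ) (R : ℕ) : ℝ :=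
  1 + ∑ r ∈ Finset.Icc 1 R, ∑ k ∈ Finset.Icc 1 r, Real.log (k : ℝ) ^ (1 + ε)

theorem logWeight_nonneg (ε : ℝ) (R : ℕ) : 0 ≤ logWeight ε R :=
  add_nonneg zero_le_one (Finset.sum_nonneg fun _ _ => Finset.sum_nonneg fun k _ =>
    Real.rpow_nonneg (Real.log_natCast_nonneg k) _)

/-- The birth-death chain `G_ε` with `m ≡ 1` and the weights `logWeight ε`. -/
noncomputable def logChain (ε : ℝ) : WeightedGraph ℕ :=
  birthDeathChain (logWeight ε) (fun _ => 1) (logWeight_nonneg ε) (fun _ => one_pos)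

end WeightedGraph

/-!
Stochastic completeness under a logarithmic lower bound on the sphere curvatures, and its sharpness.

The Ollivier curvature has a dual description. Since `∑ z, f z * m_x^ε z = f x + ε Δ f x`, the
Wasserstein distance of `m_x^ε` and `m_y^ε` is a supremum of functions affine in `ε`. Hence the
difference quotients are monotone in `ε` (`antitoneOn_curvatureStep`), the limit exists
(`tendsto_curvature`), and any bounded `1`-Lipschitz `f` with `f y - f x = d(x, y)` gives
`d(x, y) κ(x, y) ≤ Δ f x - Δ f y` (`curvature_le'`).

Completeness. With `f = d(x₀, ·)` this says that `Δ f` grows by at most `-κ(r)` from one sphere to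
the next, so `κ(r) ≥ -C log r` yields `Δ d(x₀, ·) ≤ A + r (C log r + 1)`
(`exists_laplacian_dist_le`). As `log log` is concave with derivative `1 / (r log r)`, the function
`log log (d(x₀, ·) + 3)` has Laplacian bounded above, and it tends to infinity because balls are
finite. The maximum principle (`stochasticallyComplete_of_exhaustion`) then shows that every
non-negative solution of the heat equation with initial value `1` is at least `1`.

Sharpness. If some non-negative `h` satisfies `Δ h ≤ -1`, the expected lifetime of the minimal
process is at most `h`. The survival probability is built by Feller's iteration
(`isHeatSolution_fellerSolution`); its time integral is bounded by `h`, so it is not identically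
`1` (`not_stochasticallyComplete_of_laplacian_le_neg_one`). On a birth-death chain with `m ≡ 1` the
tails of `∑ (n + 1) / b n` serve as `h`. For the weights `b = logWeight ε` the terms are
`O(1 / (n (log n)^(1 + ε)))`, hence summable, while the curvature of the edge from `r - 1` to `r` is
bounded below by minus the second difference of `b`, which is `-(log r)^(1 + ε)`.
-/

namespace WeightedGraph

variable {V : Type*} (G : WeightedGraph V)

/-! ### The Laplacian as a finite sum -/

/-- The finite set of neighbours of `x`. -/
noncomputable def nbrs (x : V) : Finset V := (G.locallyFinite x).toFinset

theorem mem_nbrs {x y : V} : y ∈ G.nbrs x ↔ 0 < G.w x y := by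
  simp [nbrs]

theorem w_eq_zero_of_notMem_nbrs {x y : V} (h : y ∉ G.nbrs x) : G.w x y = 0 :=
  le_antisymm (not_lt.1 fun h' => h (G.mem_nbrs.2 h')) (G.w_nonneg x y)

theorem laplacian_eq_sum (f : V → ℝ) (x : V) :
    G.laplacian f x = 1 / G.m x * ∑ y ∈ G.nbrs x, G.w x y * (f y - f x) := by
  rw [laplacian, tsum_eq_sum]
  intro y hy
  rw [G.w_eq_zero_of_notMem_nbrs hy, zero_mul]

theorem laplacian_le_laplacian {f g : V → ℝ} {x : V}
    (h : ∀ y, 0 < G.w x y → f y - f x ≤ g y - g x) : G.laplacian f x ≤ G.laplacian g x := by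
  rw [laplacian_eq_sum, laplacian_eq_sum]
  exact mul_le_mul_of_nonneg_left (Finset.sum_le_sum fun y hy =>
    mul_le_mul_of_nonneg_left (h y (G.mem_nbrs.1 hy)) (G.w_nonneg x y))
    (one_div_nonneg.2 (G.m_pos x).le)

theorem laplacian_congr {f g : V → ℝ} {x : V} (hx : f x = g x)
    (h : ∀ y, 0 < G.w x y → f y = g y) : G.laplacian f x = G.laplacian g x :=
  le_antisymm (G.laplacian_le_laplacian fun y hy => by rw [hx, h y hy])
    (G.laplacian_le_laplacian fun y hy => by rw [hx, h y hy])

theorem laplacian_const_mul (c : ℝ) (f : V → ℝ) (x : V) :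
    G.laplacian (fun y => c * f y) x = c * G.laplacian f x := by
  simp only [laplacian_eq_sum, ← mul_sub, Finset.mul_sum]
  exact Finset.sum_congr rfl fun y _ => by ring

theorem laplacian_const (c : ℝ) (x : V) : G.laplacian (fun _ => c) x = 0 := by
  simp [laplacian]

theorem laplacian_const_sub (c : ℝ) (f : V → ℝ) (x : V) :
    G.laplacian (fun y => c - f y) x = -G.laplacian f x := by
  simp only [laplacian_eq_sum, Finset.mul_sum, ← Finset.sum_neg_distrib]
  exact Finset.sum_congr rfl fun y _ => by ring

/-- The weighted vertex degree, the total jump rate at `x`. -/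
noncomputable def rate (x : V) : ℝ := 1 / G.m x * ∑ y ∈ G.nbrs x, G.w x y

theorem abs_laplacian_le_rate {f : V → ℝ} {x : V} (h : ∀ y, 0 < G.w x y → |f y - f x| ≤ 1) :
    |G.laplacian f x| ≤ G.rate x := by
  have hm := one_div_pos.2 (G.m_pos x)
  rw [laplacian_eq_sum, rate, abs_mul, abs_of_pos hm]
  gcongr
  refine (Finset.abs_sum_le_sum_abs _ _).trans (Finset.sum_le_sum fun y hy => ?_)
  rw [abs_mul, abs_of_nonneg (G.w_nonneg x y)]
  exact mul_le_of_le_one_right (G.w_nonneg x y) (h y (G.mem_nbrs.1 hy))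

theorem dist_eq_one_of_w_pos {x y : V} (h : 0 < G.w x y) : G.dist x y = 1 :=
  SimpleGraph.dist_eq_one_iff_adj.2 h

theorem IsLip1.abs_laplacian_le_rate {G : WeightedGraph V} {f : V → ℝ} (hf : G.IsLip1 f) (x : V) :
    |G.laplacian f x| ≤ G.rate x :=
  G.abs_laplacian_le_rate fun y hy => by
    have h := hf x y
    rwa [G.dist_eq_one_of_w_pos hy, Nat.cast_one, abs_sub_comm] at h

/-! ### The Wasserstein distance of two step measures -/

theorem hasSum_mul_stepMeasure (ε : ℝ) (f : V → ℝ) (x : V) :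
    HasSum (fun z => f z * G.stepMeasure ε x z) (f x + ε * G.laplacian f x) := by
  classical
  have key : ∀ y, HasSum (fun z => f z * Pi.single (M := fun _ => ℝ) z 1 y) (f y) := fun y => by
    convert hasSum_ite_eq y (f y) using 2 with z
    simp only [Pi.single_apply, eq_comm (a := y), mul_ite, mul_one, mul_zero]
    split_ifs with h <;> simp [h]
  rw [laplacian_eq_sum]
  convert (key x).add ((hasSum_sum (s := G.nbrs x) fun y _ =>
    ((key y).sub (key x)).mul_left (G.w x y)).mul_left (1 / G.m x) |>.mul_left ε) using 2 with z
  rw [stepMeasure, laplacian_eq_sum]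
  simp only [Finset.mul_sum, mul_add]
  congr 1
  exact Finset.sum_congr rfl fun y _ => by ring

theorem tsum_mul_stepMeasure_sub (ε : ℝ) (f : V → ℝ) (x y : V) :
    ∑' z, f z * (G.stepMeasure ε x z - G.stepMeasure ε y z) =
      f x - f y + ε * (G.laplacian f x - G.laplacian f y) := by
  have h := ((G.hasSum_mul_stepMeasure ε f x).sub (G.hasSum_mul_stepMeasure ε f y)).tsum_eq
  simp only [mul_sub] at h ⊢
  rw [h]
  ring

theorem wasserstein_stepMeasure_le {ε a : ℝ} {x y : V}
    (h : ∀ f : V → ℝ, G.IsLip1 f → (∃ C, ∀ x, |f x| ≤ C) →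
      f x - f y + ε * (G.laplacian f x - G.laplacian f y) ≤ a) :
    G.wasserstein (G.stepMeasure ε x) (G.stepMeasure ε y) ≤ a := by
  refine csSup_le ⟨_, 0, fun x y => by simp, ⟨0, by simp⟩, rfl⟩ ?_
  rintro _ ⟨f, hf, hfb, rfl⟩
  rw [tsum_mul_stepMeasure_sub]
  exact h f hf hfb

theorem le_wasserstein_stepMeasure {ε : ℝ} (hε : 0 ≤ ε) {f : V → ℝ} (hf : G.IsLip1 f)
    (hb : ∃ C, ∀ x, |f x| ≤ C) (x y : V) :
    f x - f y + ε * (G.laplacian f x - G.laplacian f y) ≤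
      G.wasserstein (G.stepMeasure ε x) (G.stepMeasure ε y) := by
  refine le_csSup ⟨G.dist x y + ε * (G.rate x + G.rate y), ?_⟩
    ⟨f, hf, hb, (G.tsum_mul_stepMeasure_sub ε f x y).symm⟩
  rintro _ ⟨g, hg, -, rfl⟩
  rw [tsum_mul_stepMeasure_sub]
  have h1 := (abs_le.1 (hg x y)).2
  have h2 := (abs_le.1 (hg.abs_laplacian_le_rate x)).2
  have h3 := (abs_le.1 (hg.abs_laplacian_le_rate y)).1
  gcongr
  linarith

/-! ### Existence of the Ollivier curvature and bounds for it -/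

theorem isLip1_dist (hG : G.toSimpleGraph.Connected) (x₀ : V) :
    G.IsLip1 fun z => (G.dist x₀ z : ℝ) := fun x y => by
  have h1 : G.dist x₀ x ≤ G.dist x₀ y + G.dist y x := hG.dist_triangle
  have h2 : G.dist x₀ y ≤ G.dist x₀ x + G.dist x y := hG.dist_triangle
  have h3 : G.dist y x = G.dist x y := SimpleGraph.dist_comm
  rw [h3] at h1
  rify at h1 h2
  rw [abs_le]
  constructor <;> linarith

theorem IsLip1.min_const {G : WeightedGraph V} {f : V → ℝ} (hf : G.IsLip1 f) (c : ℝ) :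
    G.IsLip1 fun z => min (f z) c := fun x y =>
  (abs_min_sub_min_le_max _ _ _ _).trans (by simpa using hf x y)

theorem dist_pos (hG : G.toSimpleGraph.Connected) {x y : V} (hxy : x ≠ y) : 0 < G.dist x y :=
  hG.pos_dist_of_ne hxy

/-- A bounded `1`-Lipschitz function along which the distance of `x` and `y` is attained bounds the
difference quotients in the definition of the curvature. -/
theorem curvatureStep_le (hG : G.toSimpleGraph.Connected) {x y : V} (hxy : x ≠ y)
    {f : V → ℝ} (hf : G.IsLip1 f) (hb : ∃ C, ∀ x, |f x| ≤ C) (hfxy : f x - f y = G.dist x y)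
    {ε : ℝ} (hε : 0 < ε) :
    1 / ε * G.curvatureStep ε x y ≤ (G.laplacian f y - G.laplacian f x) / G.dist x y := by
  have hd : (0 : ℝ) < G.dist x y := Nat.cast_pos.2 (G.dist_pos hG hxy)
  have h := G.le_wasserstein_stepMeasure hε.le hf hb x y
  rw [hfxy] at h
  rw [curvatureStep, one_sub_div hd.ne', ← mul_div_assoc]
  gcongr
  rw [one_div, inv_mul_le_iff₀ hε]
  linarith

/-- The difference quotients increase as `ε` decreases, because the Wasserstein distance is a
supremum of affine functions of `ε`, with value at most `d(x, y)` at `ε = 0`. -/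
theorem antitoneOn_curvatureStep (hG : G.toSimpleGraph.Connected) {x y : V} (hxy : x ≠ y) :
    AntitoneOn (fun ε => 1 / ε * G.curvatureStep ε x y) (Set.Ioi 0) := by
  intro s hs t ht hst
  simp only [Set.mem_Ioi] at hs ht
  have hd : (0 : ℝ) < G.dist x y := Nat.cast_pos.2 (G.dist_pos hG hxy)
  have hW : G.wasserstein (G.stepMeasure s x) (G.stepMeasure s y) ≤ (1 - s / t) * G.dist x y +
        s / t * G.wasserstein (G.stepMeasure t x) (G.stepMeasure t y) := by
    refine G.wasserstein_stepMeasure_le fun g hg hgb => ?_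
    have h1 := (abs_le.1 (hg x y)).2
    have h2 := G.le_wasserstein_stepMeasure ht.le hg hgb x y
    have h3 : 0 ≤ 1 - s / t := sub_nonneg.2 ((div_le_one ht).2 hst)
    have h4 : 0 ≤ s / t := by positivity
    have h5 := mul_le_mul_of_nonneg_left h1 h3
    have h6 := mul_le_mul_of_nonneg_left h2 h4
    have h7 : s / t * t = s := div_mul_cancel₀ s ht.ne'
    calc _ = (1 - s / t) * (g x - g y) +
          s / t * (g x - g y + t * (G.laplacian g x - G.laplacian g y)) := by
          linear_combination (-(G.laplacian g x - G.laplacian g y)) * h7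
      _ ≤ _ := add_le_add h5 h6
  set Wt := G.wasserstein (G.stepMeasure t x) (G.stepMeasure t y)
  set Ws := G.wasserstein (G.stepMeasure s x) (G.stepMeasure s y)
  set d := (G.dist x y : ℝ)
  have e1 : 1 / t * G.curvatureStep t x y = (d - Wt) / (t * d) := by
    change 1 / t * (1 - Wt / d) = _
    field_simp
  have e2 : 1 / s * G.curvatureStep s x y = (d - Ws) / (s * d) := by
    change 1 / s * (1 - Ws / d) = _
    field_simp
  change 1 / t * G.curvatureStep t x y ≤ 1 / s * G.curvatureStep s x y
  rw [e1, e2, div_le_div_iff₀ (by positivity) (by positivity)]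
  have h8 : t * Ws ≤ (t - s) * d + s * Wt := by
    have := mul_le_mul_of_nonneg_left hW ht.le
    calc t * Ws ≤ _ := this
      _ = _ := by field_simp
  nlinarith

theorem tendsto_curvature (hG : G.toSimpleGraph.Connected) {x y : V} (hxy : x ≠ y) :
    Tendsto (fun ε => 1 / ε * G.curvatureStep ε x y) (𝓝[>] 0) (𝓝 (G.curvature x y)) := by
  refine tendsto_nhds_limUnder ⟨_, (G.antitoneOn_curvatureStep hG hxy).tendsto_nhdsGT ?_⟩
  have hL : G.IsLip1 fun z => min (G.dist y z : ℝ) (G.dist x y) := (G.isLip1_dist hG y).min_const _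
  have hb : ∃ C : ℝ, ∀ z, |min (G.dist y z : ℝ) (G.dist x y)| ≤ C := ⟨G.dist x y, fun z => by
    rw [abs_of_nonneg (by positivity)]
    exact min_le_right _ _⟩
  exact ⟨_, Set.forall_mem_image.2 fun ε hε => G.curvatureStep_le hG hxy hL hb
    (by simp [dist, SimpleGraph.dist_comm]) hε⟩

theorem curvature_le (hG : G.toSimpleGraph.Connected) {x y : V} (hxy : x ≠ y)
    {f : V → ℝ} (hf : G.IsLip1 f) (hb : ∃ C, ∀ x, |f x| ≤ C) (hfxy : f x - f y = G.dist x y) :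
    G.curvature x y ≤ (G.laplacian f y - G.laplacian f x) / G.dist x y :=
  le_of_tendsto (G.tendsto_curvature hG hxy) (eventually_mem_nhdsWithin.mono fun _ hε =>
    G.curvatureStep_le hG hxy hf hb hfxy hε)

/-- Reversing the sign of the test function in `curvature_le`. -/
theorem curvature_le' (hG : G.toSimpleGraph.Connected) {x y : V} (hxy : x ≠ y)
    {f : V → ℝ} (hf : G.IsLip1 f) (hb : ∃ C, ∀ x, |f x| ≤ C) (hfxy : f y - f x = G.dist x y) :
    G.curvature x y ≤ (G.laplacian f x - G.laplacian f y) / G.dist x y := by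
  have h := G.curvature_le hG hxy (f := fun z => 0 - f z)
    (fun a b => by rw [show 0 - f a - (0 - f b) = f b - f a by ring, abs_sub_comm]; exact hf a b)
    (hb.imp fun C hC z => by rw [zero_sub, abs_neg]; exact hC z) (by rw [← hfxy]; ring)
  simpa only [laplacian_const_sub, neg_sub_neg] using h

theorem le_curvature (hG : G.toSimpleGraph.Connected) {x y : V} (hxy : x ≠ y) {a : ℝ}
    (h : ∀ᶠ ε in 𝓝[>] (0 : ℝ), ∀ f : V → ℝ, G.IsLip1 f →
      f x - f y + ε * (G.laplacian f x - G.laplacian f y) ≤ G.dist x y * (1 - ε * a)) :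
    a ≤ G.curvature x y := by
  have hd : (0 : ℝ) < G.dist x y := Nat.cast_pos.2 (G.dist_pos hG hxy)
  refine ge_of_tendsto (G.tendsto_curvature hG hxy) ?_
  filter_upwards [h, self_mem_nhdsWithin] with ε hε hε0
  have hε0 : 0 < ε := hε0
  have hW := G.wasserstein_stepMeasure_le fun f hf _ => hε f hf
  rw [curvatureStep, one_div, le_inv_mul_iff₀ hε0, le_sub_comm, div_le_iff₀ hd]
  linarith
/-! ### The maximum principle and stochastic completeness -/

/-- If a function on `[0, t]` attains its maximum at the right end point `t > 0`, its derivative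
there is non-negative. -/
theorem _root_.HasDerivWithinAt.nonneg_of_forall_le_right {F : ℝ → ℝ} {D t : ℝ} (ht : 0 < t)
    (hF : HasDerivWithinAt F D (Set.Ici 0) t) (hmax : ∀ s, 0 ≤ s → s ≤ t → F s ≤ F t) :
    0 ≤ D := by
  have h := (hF.hasDerivAt (Ici_mem_nhds ht)).tendsto_slope.mono_left
    (nhdsWithin_mono t (fun s (hs : s ∈ Set.Iio t) => hs.ne))
  refine ge_of_tendsto h ?_
  filter_upwards [Ioo_mem_nhdsLT ht] with s hs
  rw [slope_def_field]
  exact div_nonneg_of_nonpos (sub_nonpos.2 (hmax s hs.1.le hs.2.le)) (sub_nonpos.2 hs.2.le)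

/-- Maximum principle: an exhaustion function `ψ` with `Δ ψ ≤ K` dominates the deficit `1 - v`
of a heat solution `v` with initial value `1`, at every scale `δ`. -/
theorem one_sub_le_of_exhaustion {ψ : V → ℝ} (hψ0 : ∀ x, 0 ≤ ψ x)
    (hψ : ∀ c, {x | ψ x ≤ c}.Finite) {K : ℝ} (hK : 0 ≤ K) (hΔ : ∀ x, G.laplacian ψ x ≤ K)
    {v : ℝ → V → ℝ} (hv : G.IsHeatSolution (fun _ => 1) v) {δ : ℝ} (hδ : 0 < δ)
    {T : ℝ} (hT : 0 ≤ T) (x : V) : 1 - v T x ≤ δ * (ψ x + (K + 1) * T) := by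
  by_contra! hlt
  let F : ℝ → V → ℝ := fun t z => 1 - v t z - δ * (ψ z + (K + 1) * t)
  have hF0 : 0 < F T x := sub_pos.2 hlt
  -- Outside the finite set `ψ ≤ 1 / δ` the function `F` is negative, as `1 - v ≤ 1`.
  have hout : ∀ t, 0 ≤ t → ∀ z, 1 / δ < ψ z → F t z < 0 := fun t ht z hz => by
    have h1 := hv.nonneg t ht z
    rw [div_lt_iff₀' hδ] at hz
    have h2 : 0 ≤ δ * ((K + 1) * t) := by positivity
    simp only [F]
    linarith
  have hxS : x ∈ (hψ (1 / δ)).toFinset := by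
    by_contra hx
    exact (hout T hT x (by simpa using hx)).not_gt hF0
  have hFc : ∀ z, ContinuousOn (fun t => F t z) (Set.Icc 0 T) := fun z =>
    (continuousOn_const.sub ((hv.continuousOn z).mono Set.Icc_subset_Ici_self)).sub
      (by fun_prop)
  have hex : ∀ z, ∃ t ∈ Set.Icc 0 T, ∀ s ∈ Set.Icc 0 T, F s z ≤ F t z := fun z =>
    isCompact_Icc.exists_isMaxOn ⟨0, by simpa using hT⟩ (hFc z)
  choose τ hτ hτmax using hex
  obtain ⟨z, hzS, hz⟩ := Finset.exists_max_image _ (fun z => F (τ z) z) ⟨x, hxS⟩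
  have hpos : 0 < F (τ z) z :=
    hF0.trans_le ((hτmax x T ⟨hT, le_rfl⟩).trans (hz x hxS))
  have hmax : ∀ y, F (τ z) y ≤ F (τ z) z := fun y => by
    by_cases hy : y ∈ (hψ (1 / δ)).toFinset
    · exact (hτmax y _ (hτ z)).trans (hz y hy)
    · exact ((hout _ (hτ z).1 y (by simpa using hy)).trans hpos).le
  have ht0 : 0 < τ z := by
    refine (hτ z).1.lt_of_ne fun h0 => hpos.not_ge ?_
    simp only [F, ← h0, hv.initial]
    have := mul_nonneg hδ.le (hψ0 z)
    linarith
  have hderiv : HasDerivWithinAt (fun s => F s z) (-G.laplacian (v (τ z)) z - δ * (K + 1))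
      (Set.Ici 0) (τ z) := by
    refine ((hv.heat (τ z) ht0.le z).const_sub 1).sub
      (((((hasDerivWithinAt_id _ _).const_mul (K + 1)).const_add (ψ z)).const_mul δ).congr_deriv ?_)
    ring
  have h1 := hderiv.nonneg_of_forall_le_right ht0 fun s hs hst =>
    hτmax z s ⟨hs, hst.trans (hτ z).2⟩
  have h2 : G.laplacian (fun y => 0 - v (τ z) y) z ≤ G.laplacian (fun y => δ * ψ y) z :=
    G.laplacian_le_laplacian fun y _ => by
      have := hmax y
      simp only [F] at this
      linarith
  rw [laplacian_const_sub, laplacian_const_mul] at h2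
  have h3 := mul_le_mul_of_nonneg_left (hΔ z) hδ.le
  linarith

/-- Khas'minskii's criterion: a non-negative function with finite sublevel sets and Laplacian
bounded from above forces stochastic completeness. -/
theorem stochasticallyComplete_of_exhaustion {ψ : V → ℝ} (hψ0 : ∀ x, 0 ≤ ψ x)
    (hψ : ∀ c, {x | ψ x ≤ c}.Finite) {K : ℝ} (hK : 0 ≤ K) (hΔ : ∀ x, G.laplacian ψ x ≤ K) :
    G.StochasticallyComplete := by
  refine ⟨fun _ _ => 1, ⟨⟨fun _ _ _ => zero_le_one, ⟨1, fun _ _ _ => le_rfl⟩,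
    fun _ => continuousOn_const, fun t _ x => ?_, fun _ => rfl⟩, fun v hv t ht x => ?_⟩,
    fun _ _ _ => rfl⟩
  · rw [laplacian_const]
    exact hasDerivWithinAt_const _ _ _
  · have hlim : Tendsto (fun δ : ℝ => δ * (ψ x + (K + 1) * t)) (𝓝[>] 0) (𝓝 0) := by
      refine Tendsto.mono_left ?_ nhdsWithin_le_nhds
      exact Continuous.tendsto' (by fun_prop) _ _ (by simp)
    have := ge_of_tendsto hlim (eventually_mem_nhdsWithin.mono fun δ hδ =>
      G.one_sub_le_of_exhaustion hψ0 hψ hK hΔ hv hδ ht x)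
    linarith

/-! ### Laplacian comparison for the distance function -/

theorem finite_dist_le (hG : G.toSimpleGraph.Connected) (x₀ : V) (n : ℕ) :
    {x | G.dist x₀ x ≤ n}.Finite := by
  induction n with
  | zero =>
    refine (Set.finite_singleton x₀).subset fun x hx => ?_
    exact ((hG.dist_eq_zero_iff).1 (Nat.le_zero.1 hx)).symm
  | succ n ih =>
    refine (ih.union (ih.biUnion fun x _ => G.locallyFinite x)).subset fun y hy => ?_
    obtain ⟨p, hp⟩ := hG.exists_walk_length_eq_dist x₀ y
    by_cases hnil : p.Nil
    · left
      have : G.dist x₀ y = 0 := hp.symm.trans (SimpleGraph.Walk.length_eq_zero_iff.2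
        hnil)
      simp [this]
    · right
      refine Set.mem_biUnion (x := p.penultimate) ?_ (p.adj_penultimate hnil)
      have h1 : G.dist x₀ p.penultimate ≤ p.dropLast.length := SimpleGraph.dist_le _
      have h2 : p.length ≤ n + 1 := hp.trans_le hy
      have h3 : p.dropLast.length = p.length - 1 := by simp
      have h4 : p.length ≠ 0 := mt SimpleGraph.Walk.length_eq_zero_iff.1 hnil
      simp only [Set.mem_ofPred_eq]
      omega

/-- Across an edge leading away from the root, the Laplacian of the distance to the root increases
by at most the negative of the curvature. -/
theorem laplacian_dist_le (hG : G.toSimpleGraph.Connected) {x₀ x y : V}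
    (hd : G.dist x₀ x + 1 = G.dist x₀ y) (hxy : G.toSimpleGraph.Adj x y) :
    G.laplacian (fun z => (G.dist x₀ z : ℝ)) y ≤
      G.laplacian (fun z => (G.dist x₀ z : ℝ)) x - G.curvature x y := by
  have h1 : G.dist x y = 1 := G.dist_eq_one_of_w_pos hxy
  -- The distance is truncated beyond the neighbourhoods of `x` and `y`, to be bounded.
  have htrunc : ∀ a, G.dist x₀ a ≤ G.dist x₀ y →
      min (G.dist x₀ a : ℝ) (G.dist x₀ y + 1) = G.dist x₀ a ∧
      G.laplacian (fun z => min (G.dist x₀ z : ℝ) (G.dist x₀ y + 1)) a =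
        G.laplacian (fun z => (G.dist x₀ z : ℝ)) a := fun a ha => by
    have e : min (G.dist x₀ a : ℝ) (G.dist x₀ y + 1) = G.dist x₀ a :=
      min_eq_left (by exact_mod_cast ha.trans (Nat.le_succ _))
    refine ⟨e, G.laplacian_congr e fun b hb => min_eq_left ?_⟩
    have h2 : G.dist x₀ b ≤ G.dist x₀ a + G.dist a b := hG.dist_triangle
    rw [G.dist_eq_one_of_w_pos hb] at h2
    exact_mod_cast h2.trans (Nat.succ_le_succ ha)
  obtain ⟨ex, eLx⟩ := htrunc x (by omega)
  obtain ⟨ey, eLy⟩ := htrunc y le_rfl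
  have h := G.curvature_le' hG hxy.ne
    ((G.isLip1_dist hG x₀).min_const (G.dist x₀ y + 1 : ℝ))
    ⟨(G.dist x₀ y + 1 : ℝ), fun z => by
      rw [abs_of_nonneg (by positivity)]; exact min_le_right _ _⟩
    (by simp only [ex, ey, h1]; rw [← hd]; push_cast; ring)
  rw [eLx, eLy, h1, Nat.cast_one, div_one] at h
  linarith

/-- Laplacian comparison: the sphere curvature bound `κ(r) ≥ -C log r` for large `r` gives
`Δ d(x₀, ·) = O(r log r)`. -/
theorem exists_laplacian_dist_le (hG : G.toSimpleGraph.Connected) (x₀ : V) {C : ℝ} (hC : 0 < C)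
    (h : ∀ᶠ r : ℕ in atTop, ((-(C * Real.log (r : ℝ)) : ℝ) : EReal) ≤ G.sphereCurvature x₀ r) :
    ∃ A, 0 ≤ A ∧ ∀ y, G.laplacian (fun z => (G.dist x₀ z : ℝ)) y ≤
      A + G.dist x₀ y * (C * Real.log (G.dist x₀ y) + 1) := by
  obtain ⟨R, hR⟩ := eventually_atTop.1 h
  obtain ⟨A, hA⟩ := ((G.finite_dist_le hG x₀ R).image
    (G.laplacian fun z => (G.dist x₀ z : ℝ))).bddAbove
  refine ⟨max A 0, le_max_right _ _, fun y => ?_⟩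
  induction hn : G.dist x₀ y using Nat.strong_induction_on generalizing y with
  | _ n ih =>
    have hlog : 0 ≤ Real.log n := Real.log_natCast_nonneg n
    rcases le_or_gt n R with hnR | hnR
    · have : G.laplacian (fun z => (G.dist x₀ z : ℝ)) y ≤ A :=
        hA ⟨y, hn.trans_le hnR, rfl⟩
      have h2 : 0 ≤ (n : ℝ) * (C * Real.log n + 1) := by positivity
      linarith [le_max_left A 0]
    · have h1 := (hR n hnR.le).trans (iInf₂_le y hn)
      -- The slack `1` spares the verification that the maximum over the neighbours is attained.
      have h2 : ((-(C * Real.log (n : ℝ)) - 1 : ℝ) : EReal) <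
          ⨆ x ∈ {x | G.dist x₀ x + 1 = n ∧ G.toSimpleGraph.Adj x y},
            ((G.curvature x y : ℝ) : EReal) :=
        lt_of_lt_of_le (EReal.coe_lt_coe_iff.2 (by linarith)) h1
      simp only [lt_iSup_iff] at h2
      obtain ⟨x, ⟨hx, hxy⟩, h3⟩ := h2
      rw [EReal.coe_lt_coe_iff] at h3
      have h4 := G.laplacian_dist_le hG (hx.trans hn.symm) hxy
      have h5 := ih (G.dist x₀ x) (by omega) x rfl
      have h6 : Real.log (G.dist x₀ x) ≤ Real.log n := by
        rcases Nat.eq_zero_or_pos (G.dist x₀ x) with h0 | h0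
        · simpa [h0] using hlog
        · exact Real.log_le_log (by exact_mod_cast h0) (by exact_mod_cast (by omega))
      have h7 : (n : ℝ) = G.dist x₀ x + 1 := by exact_mod_cast hx.symm
      have h8 : (G.dist x₀ x : ℝ) * (C * Real.log (G.dist x₀ x) + 1) ≤
          G.dist x₀ x * (C * Real.log n + 1) := by gcongr
      have h9 : (n : ℝ) * (C * Real.log n + 1) =
          G.dist x₀ x * (C * Real.log n + 1) + (C * Real.log n + 1) := by
        rw [h7]; ring
      linarith

/-! ### The exhaustion function `log log (d + 3)` -/

theorem one_lt_log_add_three {a : ℝ} (ha : 0 ≤ a) : 1 < Real.log (a + 3) := by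
  rw [Real.lt_log_iff_exp_lt (by linarith)]
  linarith [Real.exp_one_lt_d9]

/-- The concave function `log log (· + 3)` lies below its tangents. -/
theorem loglog_sub_le {a b : ℝ} (ha : 0 ≤ a) (hb : 0 ≤ b) :
    Real.log (Real.log (b + 3)) - Real.log (Real.log (a + 3)) ≤
      1 / ((a + 3) * Real.log (a + 3)) * (b - a) := by
  have hla := one_lt_log_add_three ha
  have hlb := one_lt_log_add_three hb
  have h1 : Real.log (Real.log (b + 3) / Real.log (a + 3)) ≤
      Real.log (b + 3) / Real.log (a + 3) - 1 := Real.log_le_sub_one_of_pos (by positivity)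
  have h2 : Real.log ((b + 3) / (a + 3)) ≤ (b + 3) / (a + 3) - 1 :=
    Real.log_le_sub_one_of_pos (by positivity)
  rw [Real.log_div (by positivity) (by positivity)] at h1 h2
  refine h1.trans ?_
  rw [div_sub_one (by positivity), div_le_iff₀ (by positivity)]
  refine h2.trans (le_of_eq ?_)
  field_simp
  ring

/-- Stochastic completeness from the growth `O(r log r)` of the Laplacian of the distance. -/
theorem stochasticallyComplete_of_laplacian_dist_le (hG : G.toSimpleGraph.Connected) (x₀ : V)
    {C A : ℝ} (hC : 0 ≤ C) (hA : 0 ≤ A)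
    (h : ∀ y, G.laplacian (fun z => (G.dist x₀ z : ℝ)) y ≤
      A + G.dist x₀ y * (C * Real.log (G.dist x₀ y) + 1)) : G.StochasticallyComplete := by
  have hl : ∀ n : ℕ, 1 < Real.log ((n : ℝ) + 3) := fun n => one_lt_log_add_three n.cast_nonneg
  refine G.stochasticallyComplete_of_exhaustion
    (ψ := fun z => Real.log (Real.log (G.dist x₀ z + 3))) (K := A + C + 1)
    (fun z => Real.log_nonneg (hl _).le) (fun c => ?_) (by linarith) (fun y => ?_)
  · obtain ⟨N, hN⟩ := exists_nat_ge (Real.exp (Real.exp c))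
    refine (G.finite_dist_le hG x₀ N).subset fun z hz => ?_
    have hz : Real.log (Real.log (G.dist x₀ z + 3)) ≤ c := hz
    rw [Real.log_le_iff_le_exp (by linarith [hl (G.dist x₀ z)]),
      Real.log_le_iff_le_exp (by positivity)] at hz
    have : (G.dist x₀ z : ℝ) ≤ N := by linarith
    exact_mod_cast this
  · have h1 : G.laplacian (fun z => Real.log (Real.log (G.dist x₀ z + 3))) y ≤
        G.laplacian (fun z => 1 / ((G.dist x₀ y + 3) * Real.log (G.dist x₀ y + 3)) *
          (G.dist x₀ z : ℝ)) y :=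
      G.laplacian_le_laplacian fun z _ => by
        rw [← mul_sub]
        exact loglog_sub_le (Nat.cast_nonneg _) (Nat.cast_nonneg _)
    rw [laplacian_const_mul] at h1
    have hn := h y
    generalize G.dist x₀ y = n at h1 hn
    have hl1 := hl n
    have hn0 : (0 : ℝ) ≤ n := n.cast_nonneg
    refine h1.trans ?_
    rw [one_div, inv_mul_le_iff₀ (by positivity)]
    refine hn.trans ?_
    have h2 : Real.log n ≤ Real.log ((n : ℝ) + 3) := by
      rcases Nat.eq_zero_or_pos n with h0 | h0
      · subst h0
        simpa using (zero_lt_one.trans hl1).le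
      · exact Real.log_le_log (by exact_mod_cast h0) (by linarith)
    have h3 : (n : ℝ) * (C * Real.log n + 1) ≤
        (n + 3) * (C * Real.log ((n : ℝ) + 3) + Real.log ((n : ℝ) + 3)) := by
      gcongr
      linarith
    have h4 : A ≤ A * ((n + 3) * Real.log ((n : ℝ) + 3)) :=
      le_mul_of_one_le_right hA (one_le_mul_of_one_le_of_one_le (by linarith) hl1.le)
    linarith
/-! ### Feller's construction of a heat solution -/

/-- The gain part `(1 / m x) ∑ y, w x y f y` of the Laplacian. -/
noncomputable def gain (f : V → ℝ) (x : V) : ℝ := 1 / G.m x * ∑ y ∈ G.nbrs x, G.w x y * f y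

theorem laplacian_eq_gain_sub (f : V → ℝ) (x : V) :
    G.laplacian f x = G.gain f x - G.rate x * f x := by
  simp only [laplacian_eq_sum, gain, rate, mul_sub, Finset.sum_sub_distrib, Finset.sum_mul,
    mul_assoc]

theorem gain_le_gain {f g : V → ℝ} (h : ∀ y, f y ≤ g y) (x : V) : G.gain f x ≤ G.gain g x :=
  mul_le_mul_of_nonneg_left (Finset.sum_le_sum fun y _ =>
    mul_le_mul_of_nonneg_left (h y) (G.w_nonneg x y)) (one_div_nonneg.2 (G.m_pos x).le)

theorem gain_nonneg {f : V → ℝ} (h : ∀ y, 0 ≤ f y) (x : V) : 0 ≤ G.gain f x := by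
  simpa [gain] using G.gain_le_gain h x

theorem gain_le_rate {f : V → ℝ} (h : ∀ y, f y ≤ 1) (x : V) : G.gain f x ≤ G.rate x := by
  simpa [gain, rate] using G.gain_le_gain h x

theorem continuous_gain {u : ℝ → V → ℝ} (hu : ∀ y, Continuous fun s => u s y) (x : V) :
    Continuous fun s => G.gain (u s) x :=
  continuous_const.mul (continuous_finsetSum _ fun y _ => continuous_const.mul (hu y))

theorem tendsto_gain {ι : Type*} {l : Filter ι} {f : ι → V → ℝ} {g : V → ℝ}
    (h : ∀ y, Tendsto (fun i => f i y) l (𝓝 (g y))) (x : V) :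
    Tendsto (fun i => G.gain (f i) x) l (𝓝 (G.gain g x)) :=
  (tendsto_finsetSum _ fun y _ => (h y).const_mul _).const_mul _

theorem integral_gain {u : ℝ → V → ℝ} (hu : ∀ y, Continuous fun s => u s y) (T : ℝ) (x : V) :
    ∫ s in (0 : ℝ)..T, G.gain (u s) x = G.gain (fun y => ∫ s in (0 : ℝ)..T, u s y) x := by
  simp only [gain, intervalIntegral.integral_const_mul]
  rw [intervalIntegral.integral_finsetSum fun y _ =>
    ((hu y).const_mul (G.w x y)).intervalIntegrable _ _]
  simp only [intervalIntegral.integral_const_mul]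

/-- One step of Feller's iteration: the solution `y` of `y' = -q y + gain (u t) x`, `y 0 = 1`, with
`q` the jump rate at `x`, by variation of constants. Only the values of `u` at non-negative times
enter; freezing `u` at negative times makes one-sided derivatives at `0` two-sided. -/
noncomputable def fellerStep (u : ℝ → V → ℝ) (t : ℝ) (x : V) : ℝ :=
  Real.exp (-(G.rate x * t)) *
    (1 + ∫ s in (0 : ℝ)..t, Real.exp (G.rate x * s) * G.gain (u (max s 0)) x)

variable {G}

theorem fellerStep_zero_time (u : ℝ → V → ℝ) (x : V) : G.fellerStep u 0 x = 1 := by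
  simp [fellerStep]

theorem continuous_exp_mul_gain {u : ℝ → V → ℝ} (hu : ∀ y, Continuous fun s => u (max s 0) y)
    (x : V) : Continuous fun s => Real.exp (G.rate x * s) * G.gain (u (max s 0)) x :=
  (by fun_prop : Continuous fun s => Real.exp (G.rate x * s)).mul
    (G.continuous_gain (u := fun s => u (max s 0)) hu x)

theorem hasDerivAt_fellerStep {u : ℝ → V → ℝ} (hu : ∀ y, Continuous fun s => u (max s 0) y)
    (t : ℝ) (x : V) : HasDerivAt (fun t => G.fellerStep u t x)
      (G.gain (u (max t 0)) x - G.rate x * G.fellerStep u t x) t := by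
  have hc := continuous_exp_mul_gain (G := G) hu x
  have h1 : HasDerivAt
      (fun t => 1 + ∫ s in (0 : ℝ)..t, Real.exp (G.rate x * s) * G.gain (u (max s 0)) x)
      (Real.exp (G.rate x * t) * G.gain (u (max t 0)) x) t :=
    (intervalIntegral.integral_hasDerivAt_right (hc.intervalIntegrable _ _)
      (hc.stronglyMeasurableAtFilter _ _) hc.continuousAt).const_add 1
  have h2 : HasDerivAt (fun t => Real.exp (-(G.rate x * t)))
      (Real.exp (-(G.rate x * t)) * -(G.rate x * 1)) t :=
    (((hasDerivAt_id t).const_mul (G.rate x)).neg).exp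
  refine (h2.mul h1).congr_deriv ?_
  have h3 : Real.exp (-(G.rate x * t)) * Real.exp (G.rate x * t) = 1 := by
    rw [← Real.exp_add]; simp
  rw [fellerStep]
  linear_combination G.gain (u (max t 0)) x * h3

theorem continuous_fellerStep {u : ℝ → V → ℝ} (hu : ∀ y, Continuous fun s => u (max s 0) y)
    (x : V) : Continuous fun t => G.fellerStep u t x :=
  continuous_iff_continuousAt.2 fun t => (hasDerivAt_fellerStep hu t x).continuousAt

theorem fellerStep_mono {u v : ℝ → V → ℝ} (hu : ∀ y, Continuous fun s => u (max s 0) y)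
    (hv : ∀ y, Continuous fun s => v (max s 0) y) (h : ∀ t, 0 ≤ t → ∀ y, u t y ≤ v t y)
    {t : ℝ} (ht : 0 ≤ t) (x : V) : G.fellerStep u t x ≤ G.fellerStep v t x := by
  have := intervalIntegral.integral_mono_on (μ := MeasureTheory.volume) ht
    ((continuous_exp_mul_gain (G := G) hu x).intervalIntegrable _ _)
    ((continuous_exp_mul_gain (G := G) hv x).intervalIntegrable _ _) fun s _ =>
    mul_le_mul_of_nonneg_left (G.gain_le_gain (h _ (le_max_right s 0)) x) (Real.exp_pos _).le
  unfold fellerStep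
  gcongr

theorem fellerStep_nonneg {u : ℝ → V → ℝ} (h : ∀ t, 0 ≤ t → ∀ y, 0 ≤ u t y)
    {t : ℝ} (ht : 0 ≤ t) (x : V) : 0 ≤ G.fellerStep u t x := by
  refine mul_nonneg (Real.exp_pos _).le (add_nonneg zero_le_one ?_)
  exact intervalIntegral.integral_nonneg ht fun s _ =>
    mul_nonneg (Real.exp_pos _).le (G.gain_nonneg (h _ (le_max_right s 0)) x)

theorem fellerStep_le_one {u : ℝ → V → ℝ} (hu : ∀ y, Continuous fun s => u (max s 0) y)
    (h : ∀ t, 0 ≤ t → ∀ y, u t y ≤ 1)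
    {t : ℝ} (ht : 0 ≤ t) (x : V) : G.fellerStep u t x ≤ 1 := by
  have hcq : Continuous fun s => Real.exp (G.rate x * s) * G.rate x := by fun_prop
  have h1 := intervalIntegral.integral_mono_on (μ := MeasureTheory.volume) ht
    ((continuous_exp_mul_gain (G := G) hu x).intervalIntegrable _ _)
    (hcq.intervalIntegrable _ _) fun s _ =>
    mul_le_mul_of_nonneg_left (G.gain_le_rate (h _ (le_max_right s 0)) x) (Real.exp_pos _).le
  have h2 : ∫ s in (0 : ℝ)..t, Real.exp (G.rate x * s) * G.rate x =
      Real.exp (G.rate x * t) - Real.exp (G.rate x * 0) :=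
    intervalIntegral.integral_eq_sub_of_hasDerivAt (f := fun s => Real.exp (G.rate x * s))
      (fun s _ => by simpa using ((hasDerivAt_id s).const_mul (G.rate x)).exp)
      (hcq.intervalIntegrable _ _)
  rw [h2, mul_zero, Real.exp_zero] at h1
  calc G.fellerStep u t x ≤ Real.exp (-(G.rate x * t)) * Real.exp (G.rate x * t) :=
        mul_le_mul_of_nonneg_left (by linarith) (Real.exp_pos _).le
    _ = 1 := by rw [← Real.exp_add]; simp

variable (G)

/-- Feller's iterates: `fellerIter n t x` is the probability that the process started at `x` makes
fewer than `n` jumps up to time `t`. -/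
noncomputable def fellerIter (n : ℕ) : ℝ → V → ℝ := G.fellerStep^[n] fun _ _ => 0

theorem fellerIter_succ (n : ℕ) : G.fellerIter (n + 1) = G.fellerStep (G.fellerIter n) :=
  Function.iterate_succ_apply' _ _ _

theorem continuous_fellerIter (n : ℕ) (x : V) : Continuous fun t => G.fellerIter n t x := by
  induction n generalizing x with
  | zero => exact continuous_const
  | succ n ih =>
    rw [fellerIter_succ]
    exact continuous_fellerStep (fun y => (ih y).comp (continuous_id.max continuous_const)) x

theorem continuous_fellerIter_max (n : ℕ) (x : V) :
    Continuous fun t => G.fellerIter n (max t 0) x :=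
  (G.continuous_fellerIter n x).comp (continuous_id.max continuous_const)

theorem fellerIter_nonneg (n : ℕ) {t : ℝ} (ht : 0 ≤ t) (x : V) : 0 ≤ G.fellerIter n t x := by
  induction n generalizing t x with
  | zero => exact le_rfl
  | succ n ih =>
    rw [fellerIter_succ]
    exact fellerStep_nonneg (fun _ hs y => ih hs y) ht x

theorem fellerIter_le_one (n : ℕ) {t : ℝ} (ht : 0 ≤ t) (x : V) : G.fellerIter n t x ≤ 1 := by
  induction n generalizing t x with
  | zero => exact zero_le_one
  | succ n ih =>
    rw [fellerIter_succ]
    exact fellerStep_le_one (G.continuous_fellerIter_max n) (fun _ hs y => ih hs y) ht x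

theorem monotone_fellerIter {t : ℝ} (ht : 0 ≤ t) (x : V) :
    Monotone fun n => G.fellerIter n t x := by
  refine monotone_nat_of_le_succ fun n => ?_
  induction n generalizing t x with
  | zero => exact G.fellerIter_nonneg 1 ht x
  | succ n ih =>
    rw [G.fellerIter_succ (n + 1), G.fellerIter_succ n]
    refine fellerStep_mono (G.continuous_fellerIter_max n) ?_ (fun _ hs y => ?_) ht x
    · rw [← fellerIter_succ]
      exact G.continuous_fellerIter_max (n + 1)
    · rw [← fellerIter_succ]
      exact ih hs y

/-- The limit of Feller's iterates, the survival probability up to time `t` of the minimal process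
started at `x`. -/
noncomputable def fellerSolution (t : ℝ) (x : V) : ℝ := ⨆ n, G.fellerIter n t x

theorem tendsto_fellerIter {t : ℝ} (ht : 0 ≤ t) (x : V) :
    Tendsto (fun n => G.fellerIter n t x) atTop (𝓝 (G.fellerSolution t x)) :=
  tendsto_atTop_ciSup (G.monotone_fellerIter ht x)
    ⟨1, Set.forall_mem_range.2 fun n => G.fellerIter_le_one n ht x⟩

theorem norm_exp_mul_gain_fellerIter_le (n : ℕ) (s : ℝ) (x : V) :
    ‖Real.exp (G.rate x * s) * G.gain (G.fellerIter n (max s 0)) x‖ ≤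
      Real.exp (G.rate x * s) * G.rate x := by
  have h1 := G.gain_nonneg (G.fellerIter_nonneg n (le_max_right s 0)) x
  rw [Real.norm_of_nonneg (mul_nonneg (Real.exp_pos _).le h1)]
  exact mul_le_mul_of_nonneg_left (G.gain_le_rate (G.fellerIter_le_one n (le_max_right s 0)) x)
    (Real.exp_pos _).le

theorem tendsto_exp_mul_gain_fellerIter (s : ℝ) (x : V) :
    Tendsto (fun n => Real.exp (G.rate x * s) * G.gain (G.fellerIter n (max s 0)) x) atTop
      (𝓝 (Real.exp (G.rate x * s) * G.gain (G.fellerSolution (max s 0)) x)) :=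
  (G.tendsto_gain (G.tendsto_fellerIter (le_max_right s 0)) x).const_mul _

theorem fellerStep_fellerSolution {t : ℝ} (ht : 0 ≤ t) (x : V) :
    G.fellerStep G.fellerSolution t x = G.fellerSolution t x := by
  have hlim : Tendsto (fun n => G.fellerStep (G.fellerIter n) t x) atTop
      (𝓝 (G.fellerStep G.fellerSolution t x)) := by
    refine (Tendsto.const_add _ ?_).const_mul _
    refine intervalIntegral.tendsto_integral_filter_of_dominated_convergence
      (fun s => Real.exp (G.rate x * s) * G.rate x) (Eventually.of_forall fun n => ?_)
      (Eventually.of_forall fun n => .of_forall fun s _ =>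
        G.norm_exp_mul_gain_fellerIter_le n s x)
      (Continuous.intervalIntegrable (by fun_prop) _ _)
      (.of_forall fun s _ => G.tendsto_exp_mul_gain_fellerIter s x)
    exact (continuous_exp_mul_gain (G.continuous_fellerIter_max n) x).aestronglyMeasurable
  refine tendsto_nhds_unique hlim ?_
  simp only [← fellerIter_succ]
  exact (G.tendsto_fellerIter ht x).comp (tendsto_add_atTop_nat 1)

theorem continuous_fellerSolution_max (x : V) :
    Continuous fun s => G.fellerSolution (max s 0) x := by
  have h : Continuous fun t => G.fellerStep G.fellerSolution t x := by
    refine Continuous.mul (by fun_prop) (continuous_const.add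
      (intervalIntegral.continuous_primitive (fun a b => ?_) 0))
    have hb : IntervalIntegrable (fun s => Real.exp (G.rate x * s) * G.rate x)
      MeasureTheory.volume a b := Continuous.intervalIntegrable (by fun_prop) _ _
    refine hb.mono_fun ?_ (.of_forall fun s => ?_)
    · exact (stronglyMeasurable_of_tendsto atTop (fun n =>
        (continuous_exp_mul_gain (G.continuous_fellerIter_max n) x).stronglyMeasurable)
        (tendsto_pi_nhds.2 fun s => G.tendsto_exp_mul_gain_fellerIter s x)).aestronglyMeasurable
    · exact (le_of_tendsto (G.tendsto_exp_mul_gain_fellerIter s x).norm (.of_forall fun n =>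
        G.norm_exp_mul_gain_fellerIter_le n s x)).trans (le_abs_self _)
  refine (h.comp (continuous_id.max (continuous_const (y := (0 : ℝ))))).congr fun s => ?_
  exact G.fellerStep_fellerSolution (le_max_right s 0) x

theorem isHeatSolution_fellerSolution : G.IsHeatSolution (fun _ => 1) G.fellerSolution where
  nonneg t ht x := ge_of_tendsto' (G.tendsto_fellerIter ht x) fun n => G.fellerIter_nonneg n ht x
  bounded := ⟨1, fun t ht x =>
    le_of_tendsto' (G.tendsto_fellerIter ht x) fun n => G.fellerIter_le_one n ht x⟩
  continuousOn x := (G.continuous_fellerSolution_max x).continuousOn.congr fun t ht => by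
    simp only [max_eq_left (Set.mem_Ici.1 ht)]
  heat t ht x := by
    have h := (hasDerivAt_fellerStep (G := G) G.continuous_fellerSolution_max t x).hasDerivWithinAt
      (s := Set.Ici 0)
    rw [max_eq_left ht, G.fellerStep_fellerSolution ht, ← laplacian_eq_gain_sub] at h
    exact h.congr_of_mem (fun s hs => (G.fellerStep_fellerSolution hs x).symm) ht
  initial x := by rw [← G.fellerStep_fellerSolution le_rfl, fellerStep_zero_time]

/-! ### Finite expected lifetime and stochastic incompleteness -/

theorem rate_pos_of_laplacian_ne_zero {f : V → ℝ} {x : V} (h : G.laplacian f x ≠ 0) :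
    0 < G.rate x := by
  refine mul_pos (one_div_pos.2 (G.m_pos x)) (Finset.sum_pos (fun y hy => G.mem_nbrs.1 hy) ?_)
  by_contra hne
  rw [Finset.not_nonempty_iff_eq_empty] at hne
  exact h (by rw [laplacian_eq_sum, hne, Finset.sum_empty, mul_zero])

variable {G}

/-- A non-negative `h` with `Δ h ≤ -1` bounds the expected lifetime `∫ P(alive at s) ds`. -/
theorem integral_fellerIter_le {h : V → ℝ} (h0 : ∀ x, 0 ≤ h x) (hΔ : ∀ x, G.laplacian h x ≤ -1)
    (n : ℕ) {T : ℝ} (hT : 0 ≤ T) (x : V) : ∫ s in (0 : ℝ)..T, G.fellerIter n s x ≤ h x := by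
  induction n generalizing x with
  | zero => simpa [fellerIter] using h0 x
  | succ n ih =>
    have hq : 0 < G.rate x :=
      G.rate_pos_of_laplacian_ne_zero (f := h) (by linarith [hΔ x] : G.laplacian h x < 0).ne
    have hc1 := (G.continuous_gain (G.continuous_fellerIter n) x).intervalIntegrable
      (μ := MeasureTheory.volume) 0 T
    have hc2 := ((G.continuous_fellerIter (n + 1) x).const_mul (G.rate x)).intervalIntegrable
      (μ := MeasureTheory.volume) 0 T
    have hftc : ∫ s in (0 : ℝ)..T, (G.gain (G.fellerIter n s) x -
        G.rate x * G.fellerIter (n + 1) s x) =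
          G.fellerIter (n + 1) T x - G.fellerIter (n + 1) 0 x := by
      refine intervalIntegral.integral_eq_sub_of_hasDerivAt
        (f := fun s => G.fellerIter (n + 1) s x) (fun s hs => ?_) (hc1.sub hc2)
      rw [Set.uIcc_of_le hT] at hs
      have := hasDerivAt_fellerStep (G := G) (G.continuous_fellerIter_max n) s x
      rwa [max_eq_left hs.1, ← fellerIter_succ] at this
    rw [intervalIntegral.integral_sub hc1 hc2, intervalIntegral.integral_const_mul,
      G.integral_gain (G.continuous_fellerIter n)] at hftc
    have h1 := G.gain_le_gain ih x
    have h2 := G.fellerIter_nonneg (n + 1) hT x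
    have h3 : G.fellerIter (n + 1) 0 x = 1 := by rw [fellerIter_succ, fellerStep_zero_time]
    have h4 := hΔ x
    rw [laplacian_eq_gain_sub] at h4
    refine le_of_mul_le_mul_left ?_ hq
    linarith

theorem integral_fellerSolution_le {h : V → ℝ} (h0 : ∀ x, 0 ≤ h x)
    (hΔ : ∀ x, G.laplacian h x ≤ -1) {T : ℝ} (hT : 0 ≤ T) (x : V) :
    ∫ s in (0 : ℝ)..T, G.fellerSolution s x ≤ h x := by
  have hpos : ∀ s ∈ Set.uIoc 0 T, 0 ≤ s := fun s hs => by
    rw [Set.uIoc_of_le hT] at hs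
    exact hs.1.le
  refine le_of_tendsto' (intervalIntegral.tendsto_integral_filter_of_dominated_convergence
    (fun _ => 1) (.of_forall fun n => (G.continuous_fellerIter n x).aestronglyMeasurable)
    (.of_forall fun n => .of_forall fun s hs => ?_) intervalIntegrable_const
    (.of_forall fun s hs => G.tendsto_fellerIter (hpos s hs) x))
    fun n => integral_fellerIter_le h0 hΔ n hT x
  rw [Real.norm_of_nonneg (G.fellerIter_nonneg n (hpos s hs) x)]
  exact G.fellerIter_le_one n (hpos s hs) x

theorem not_stochasticallyComplete_of_laplacian_le_neg_one [Nonempty V] {h : V → ℝ}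
    (h0 : ∀ x, 0 ≤ h x) (hΔ : ∀ x, G.laplacian h x ≤ -1) : ¬ G.StochasticallyComplete := by
  rintro ⟨u, hu, hu1⟩
  obtain ⟨x⟩ := ‹Nonempty V›
  have hsol := G.isHeatSolution_fellerSolution
  have hT : 0 ≤ h x + 1 := by linarith [h0 x]
  have h1 : ∀ s ∈ Set.Icc 0 (h x + 1), (1 : ℝ) ≤ G.fellerSolution s x := fun s hs => by
    rcases hs.1.eq_or_lt with h | h
    · rw [← h, hsol.initial]
    · rw [← hu1 s h x]
      exact hu.2 _ hsol s hs.1 x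
  have h2 := intervalIntegral.integral_mono_on (μ := MeasureTheory.volume) hT
    intervalIntegrable_const (((hsol.continuousOn x).mono
      (by rw [Set.uIcc_of_le hT]; exact Set.Icc_subset_Ici_self)).intervalIntegrable) h1
  rw [intervalIntegral.integral_const, sub_zero, smul_eq_mul, mul_one] at h2
  linarith [integral_fellerSolution_le h0 hΔ hT x]

end WeightedGraph

namespace WeightedGraph

/-! ### Birth-death chains -/

section BirthDeath

variable {b m : ℕ → ℝ} {hb : ∀ n, 0 ≤ b n} {hm : ∀ n, 0 < m n}

theorem birthDeathChain_w_succ (n : ℕ) : (birthDeathChain b m hb hm).w n (n + 1) = b n :=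
  if_pos rfl

theorem birthDeathChain_eq_succ_of_adj {i j : ℕ}
    (h : (birthDeathChain b m hb hm).toSimpleGraph.Adj i j) : j = i + 1 ∨ i = j + 1 := by
  by_contra! hne
  change 0 < (birthDeathChain b m hb hm).w i j at h
  simp only [birthDeathChain] at h
  rw [if_neg hne.1, if_neg hne.2] at h
  exact lt_irrefl 0 h

theorem birthDeathChain_exists_walk (hpos : ∀ n, 0 < b n) (n : ℕ) :
    ∃ p : (birthDeathChain b m hb hm).toSimpleGraph.Walk 0 n, p.length = n := by
  induction n with
  | zero => exact ⟨.nil, rfl⟩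
  | succ n ih =>
    obtain ⟨p, hp⟩ := ih
    have hadj : (birthDeathChain b m hb hm).toSimpleGraph.Adj n (n + 1) := by
      change 0 < (birthDeathChain b m hb hm).w n (n + 1)
      rw [birthDeathChain_w_succ]
      exact hpos n
    exact ⟨p.concat hadj, by rw [SimpleGraph.Walk.length_concat, hp]⟩

theorem birthDeathChain_connected (hpos : ∀ n, 0 < b n) :
    (birthDeathChain b m hb hm).toSimpleGraph.Connected :=
  have h0 : ∀ n, (birthDeathChain b m hb hm).toSimpleGraph.Reachable 0 n := fun n =>
    (birthDeathChain_exists_walk hpos n).choose.reachable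
  ⟨fun i j => (h0 i).symm.trans (h0 j)⟩

theorem birthDeathChain_le_add_length {i j : ℕ}
    (p : (birthDeathChain b m hb hm).toSimpleGraph.Walk i j) : j ≤ i + p.length := by
  induction p with
  | nil => simp
  | cons h p ih =>
    rw [SimpleGraph.Walk.length_cons]
    have := birthDeathChain_eq_succ_of_adj h
    omega

theorem birthDeathChain_dist_zero (hpos : ∀ n, 0 < b n) (n : ℕ) :
    (birthDeathChain b m hb hm).dist 0 n = n := by
  refine le_antisymm ?_ ?_
  · obtain ⟨p, hp⟩ := birthDeathChain_exists_walk (hb := hb) (hm := hm) hpos n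
    exact (SimpleGraph.dist_le p).trans hp.le
  · obtain ⟨p, hp⟩ := (birthDeathChain_connected (hb := hb) (hm := hm)
      hpos).exists_walk_length_eq_dist 0 n
    have := birthDeathChain_le_add_length p
    rw [hp, zero_add] at this
    exact this

theorem laplacian_birthDeathChain_zero (f : ℕ → ℝ) :
    (birthDeathChain b m hb hm).laplacian f 0 = 1 / m 0 * (b 0 * (f 1 - f 0)) := by
  rw [laplacian, tsum_eq_single 1]
  · simp [birthDeathChain]
  · intro j hj
    simp [birthDeathChain, hj]

theorem laplacian_birthDeathChain_succ (f : ℕ → ℝ) (n : ℕ) :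
    (birthDeathChain b m hb hm).laplacian f (n + 1) =
      1 / m (n + 1) * (b (n + 1) * (f (n + 2) - f (n + 1)) + b n * (f n - f (n + 1))) := by
  rw [laplacian, tsum_eq_sum (s := {n + 2, n})]
  · rw [Finset.sum_pair (by omega)]
    simp [birthDeathChain, show n ≠ n + 1 + 1 by omega]
  · intro j hj
    simp only [Finset.mem_insert, Finset.mem_singleton, not_or] at hj
    simp [birthDeathChain, hj.1, Ne.symm hj.2]

/-- A birth-death chain with `m ≡ 1` explodes if `∑ (n + 1) / b n` converges: the tails of this
series form a bounded function with Laplacian `-1`. -/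
theorem not_stochasticallyComplete_birthDeathChain (hpos : ∀ n, 0 < b n)
    (hsum : Summable fun n : ℕ => ((n : ℝ) + 1) / b n) :
    ¬ (birthDeathChain b (fun _ => 1) hb fun _ => one_pos).StochasticallyComplete := by
  obtain ⟨S, hS0, hS⟩ : ∃ S : ℕ → ℝ, (∀ n, 0 ≤ S n) ∧
      ∀ n : ℕ, S n = ((n : ℝ) + 1) / b n + S (n + 1) := by
    refine ⟨fun n => ∑' k : ℕ, (((k + n : ℕ) : ℝ) + 1) / b (k + n),
      fun n => tsum_nonneg fun k => div_nonneg (by positivity) (hb _), fun n => ?_⟩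
    dsimp only
    rw [((summable_nat_add_iff n).2 hsum).tsum_eq_zero_add]
    simp only [zero_add, add_assoc, add_comm 1 n]
  have hcancel : ∀ n : ℕ, b n * (S n - S (n + 1)) = n + 1 := fun n => by
    rw [hS n, add_sub_cancel_right, mul_div_cancel₀ _ (hpos n).ne']
  refine not_stochasticallyComplete_of_laplacian_le_neg_one hS0 fun n => ?_
  cases n with
  | zero =>
    rw [laplacian_birthDeathChain_zero]
    have h := hcancel 0
    push_cast at h
    linarith
  | succ n =>
    rw [laplacian_birthDeathChain_succ]
    have h := hcancel (n + 1)
    push_cast at h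
    linarith [hcancel n]

/-- The curvature of the edge from `n + 1` to `n + 2` is at least minus the second difference of the
weights. -/
theorem le_curvature_birthDeathChain (hpos : ∀ n, 0 < b n) (n : ℕ) :
    -(b (n + 2) - 2 * b (n + 1) + b n) ≤
      (birthDeathChain b (fun _ => 1) hb fun _ => one_pos).curvature (n + 1) (n + 2) := by
  set G := birthDeathChain b (fun _ => 1) hb fun _ => one_pos
  have hadj : ∀ k, G.dist k (k + 1) = 1 := fun k => G.dist_eq_one_of_w_pos (by
    rw [birthDeathChain_w_succ]; exact hpos k)
  refine G.le_curvature (birthDeathChain_connected hpos) (by omega) ?_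
  filter_upwards [Ioo_mem_nhdsGT (show (0 : ℝ) < 1 / (2 * b (n + 1)) by
    have := hpos (n + 1); positivity)] with ε hε f hf
  have hε1 : ε * (2 * b (n + 1)) ≤ 1 := by
    have h := hpos (n + 1)
    exact ((lt_div_iff₀ (by positivity)).1 hε.2).le
  have h1 := (abs_le.1 (hf n (n + 1))).2
  have h2 := (abs_le.1 (hf (n + 1) (n + 2))).2
  have h3 := (abs_le.1 (hf (n + 2) (n + 3))).2
  rw [hadj] at h1 h2 h3
  rw [hadj, laplacian_birthDeathChain_succ, laplacian_birthDeathChain_succ]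
  push_cast at h1 h2 h3 ⊢
  -- For small `ε` the quantity is increasing in `f (n + 1) - f (n + 2)`, so the worst case is `1`.
  have h4 := mul_le_mul_of_nonneg_left h1 (mul_nonneg hε.1.le (hb n))
  have h5 := mul_le_mul_of_nonneg_left h3 (mul_nonneg hε.1.le (hb (n + 2)))
  have h6 := mul_le_mul_of_nonneg_left h2 (sub_nonneg.2 hε1)
  simp only [div_one, one_mul]
  linarith

end BirthDeath

/-! ### The chain with weights `logWeight ε` -/

theorem logWeight_pos (ε : ℝ) (n : ℕ) : 0 < logWeight ε n :=
  add_pos_of_pos_of_nonneg one_pos (Finset.sum_nonneg fun _ _ => Finset.sum_nonneg fun k _ =>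
    Real.rpow_nonneg (Real.log_natCast_nonneg k) _)

theorem logWeight_second_difference (ε : ℝ) (n : ℕ) :
    logWeight ε (n + 2) - 2 * logWeight ε (n + 1) + logWeight ε n =
      Real.log ((n + 2 : ℕ) : ℝ) ^ (1 + ε) := by
  simp only [logWeight, Finset.sum_Icc_succ_top (Nat.le_add_left 1 _)]
  ring

/-- The pairs `(r, k)` with `j < k ≤ 2 j < r ≤ 3 j` contribute at least this much. -/
theorem le_logWeight {ε : ℝ} (hε : 0 ≤ 1 + ε) {j n : ℕ} (hj : 3 * j ≤ n) :
    (j : ℝ) ^ 2 * Real.log (j + 1) ^ (1 + ε) ≤ logWeight ε n := by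
  have hterm : ∀ k : ℕ, 0 ≤ Real.log (k : ℝ) ^ (1 + ε) := fun k =>
    Real.rpow_nonneg (Real.log_natCast_nonneg k) _
  have hl : 0 ≤ Real.log ((j : ℝ) + 1) := Real.log_nonneg (by linarith [j.cast_nonneg (α := ℝ)])
  have h1 : ∀ r ∈ Finset.Ioc (2 * j) (3 * j), (j : ℝ) * Real.log (j + 1) ^ (1 + ε) ≤
      ∑ k ∈ Finset.Icc 1 r, Real.log (k : ℝ) ^ (1 + ε) := fun r hr => by
    rw [Finset.mem_Ioc] at hr
    have h2 : ∑ _k ∈ Finset.Ioc j (2 * j), Real.log ((j : ℝ) + 1) ^ (1 + ε) ≤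
        ∑ k ∈ Finset.Ioc j (2 * j), Real.log (k : ℝ) ^ (1 + ε) :=
      Finset.sum_le_sum fun k hk => by
        rw [Finset.mem_Ioc] at hk
        have hk1 : (j : ℝ) + 1 ≤ k := by exact_mod_cast hk.1
        exact Real.rpow_le_rpow hl (Real.log_le_log (by positivity) hk1) hε
    rw [Finset.sum_const, Nat.card_Ioc, nsmul_eq_mul, show 2 * j - j = j by omega] at h2
    refine h2.trans (Finset.sum_le_sum_of_subset_of_nonneg (fun k hk => ?_) fun k _ _ => hterm k)
    rw [Finset.mem_Ioc] at hk
    rw [Finset.mem_Icc]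
    omega
  have h3 := Finset.sum_le_sum h1
  rw [Finset.sum_const, Nat.card_Ioc, nsmul_eq_mul, show 3 * j - 2 * j = j by omega] at h3
  have h4 : ∑ r ∈ Finset.Ioc (2 * j) (3 * j), ∑ k ∈ Finset.Icc 1 r,
      Real.log (k : ℝ) ^ (1 + ε) ≤
      ∑ r ∈ Finset.Icc 1 n, ∑ k ∈ Finset.Icc 1 r, Real.log (k : ℝ) ^ (1 + ε) := by
    refine Finset.sum_le_sum_of_subset_of_nonneg (fun r hr => ?_) fun r _ _ =>
      Finset.sum_nonneg fun k _ => hterm k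
    rw [Finset.mem_Ioc] at hr
    rw [Finset.mem_Icc]
    omega
  rw [logWeight]
  nlinarith

theorem summable_one_div_mul_log_rpow {p : ℝ} (hp : 1 < p) :
    Summable fun n : ℕ => 1 / ((n : ℝ) * Real.log (n + 1) ^ p) := by
  have hl : ∀ n : ℕ, 0 ≤ Real.log ((n : ℝ) + 1) := fun n =>
    Real.log_nonneg (by linarith [n.cast_nonneg (α := ℝ)])
  refine (summable_condensed_iff_of_nonneg (fun n => ?_) fun a c ha hac => ?_).1 ?_
  · have := Real.rpow_nonneg (hl n) p
    positivity
  · have ha' : (0 : ℝ) < a := by exact_mod_cast ha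
    have hac' : (a : ℝ) ≤ c := by exact_mod_cast hac
    have hla : 0 < Real.log ((a : ℝ) + 1) := Real.log_pos (by linarith)
    have hll : Real.log ((a : ℝ) + 1) ≤ Real.log ((c : ℝ) + 1) :=
      Real.log_le_log (by linarith) (by linarith)
    have := Real.rpow_pos_of_pos hla p
    gcongr
  · have h2 : 0 < Real.log 2 := Real.log_pos one_lt_two
    have hs : Summable fun k : ℕ => 1 / (k : ℝ) ^ p * (1 / Real.log 2 ^ p) :=
      ((Real.summable_one_div_nat_rpow).2 hp).mul_right _
    refine (summable_nat_add_iff 1).1 (Summable.of_nonneg_of_le (fun k => ?_) (fun k => ?_)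
      ((summable_nat_add_iff 1).2 hs))
    · have := Real.rpow_nonneg (hl (2 ^ (k + 1))) p
      positivity
    · have h3 : ((k + 1 : ℕ) : ℝ) * Real.log 2 ≤ Real.log (((2 ^ (k + 1) : ℕ) : ℝ) + 1) := by
        rw [← Real.log_pow]
        exact Real.log_le_log (by positivity) (by push_cast; linarith)
      have h4 : (0 : ℝ) < ((k + 1 : ℕ) : ℝ) := by positivity
      have h5 : (((k + 1 : ℕ) : ℝ) * Real.log 2) ^ p ≤
          Real.log (((2 ^ (k + 1) : ℕ) : ℝ) + 1) ^ p :=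
        Real.rpow_le_rpow (by positivity) h3 (by linarith)
      rw [Real.mul_rpow h4.le h2.le] at h5
      have h6 : 0 < ((k + 1 : ℕ) : ℝ) ^ p * Real.log 2 ^ p :=
        mul_pos (Real.rpow_pos_of_pos h4 p) (Real.rpow_pos_of_pos h2 p)
      have h7 : (2 : ℝ) ^ (k + 1) * (1 / (((2 ^ (k + 1) : ℕ) : ℝ) *
          Real.log (((2 ^ (k + 1) : ℕ) : ℝ) + 1) ^ p)) =
          1 / Real.log (((2 ^ (k + 1) : ℕ) : ℝ) + 1) ^ p := by
        rw [← mul_div_assoc, mul_one, Nat.cast_pow, Nat.cast_ofNat]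
        exact div_mul_cancel_left₀ (by positivity) _ |>.trans (one_div _).symm
      rw [h7, one_div_mul_one_div]
      exact one_div_le_one_div_of_le h6 h5

theorem summable_add_one_div_logWeight {ε : ℝ} (hε : 0 < ε) :
    Summable fun n : ℕ => ((n : ℝ) + 1) / logWeight ε n := by
  have hs := (summable_one_div_mul_log_rpow (p := 1 + ε) (by linarith)).mul_left
    (72 * 2 ^ (1 + ε))
  refine (summable_nat_add_iff 8).1 (Summable.of_nonneg_of_le (fun n => ?_) (fun n => ?_)
    ((summable_nat_add_iff 8).2 hs))
  · exact div_nonneg (by positivity) (logWeight_nonneg ε _)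
  · have hN : 8 ≤ n + 8 := Nat.le_add_left 8 n
    generalize n + 8 = N at hN
    have hN' : (8 : ℝ) ≤ N := by exact_mod_cast hN
    have hj := le_logWeight (ε := ε) (by linarith) (Nat.mul_div_le N 3)
    have hj1 : ((N : ℝ) + 1) / 3 ≤ ((N / 3 : ℕ) : ℝ) + 1 := by
      rw [div_le_iff₀ (by norm_num)]
      exact_mod_cast (by omega : N + 1 ≤ (N / 3 + 1) * 3)
    have hj2 : (N : ℝ) / 6 ≤ ((N / 3 : ℕ) : ℝ) := by
      rw [div_le_iff₀ (by norm_num)]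
      exact_mod_cast (by omega : N ≤ N / 3 * 6)
    have hlN : 0 < Real.log ((N : ℝ) + 1) := Real.log_pos (by linarith)
    -- As `N + 1 ≥ 9`, the number `(N + 1) / 3` is at least the square root of `N + 1`.
    have hlog : Real.log ((N : ℝ) + 1) / 2 ≤ Real.log (((N / 3 : ℕ) : ℝ) + 1) := by
      rw [div_le_iff₀ two_pos, mul_comm, ← Nat.cast_ofNat (R := ℝ) (n := 2), ← Real.log_pow]
      refine Real.log_le_log (by linarith) ?_
      nlinarith
    have hpow : Real.log ((N : ℝ) + 1) ^ (1 + ε) / 2 ^ (1 + ε) ≤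
        Real.log (((N / 3 : ℕ) : ℝ) + 1) ^ (1 + ε) := by
      rw [← Real.div_rpow hlN.le two_pos.le]
      exact Real.rpow_le_rpow (by positivity) hlog (by linarith)
    have hb : ((N : ℝ) / 6) ^ 2 * (Real.log ((N : ℝ) + 1) ^ (1 + ε) / 2 ^ (1 + ε)) ≤
        logWeight ε N := by
      refine le_trans ?_ hj
      have := Real.rpow_pos_of_pos hlN (1 + ε)
      gcongr
    have hL := Real.rpow_pos_of_pos hlN (1 + ε)
    have h2 := Real.rpow_pos_of_pos (two_pos (α := ℝ)) (1 + ε)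
    calc ((N : ℝ) + 1) / logWeight ε N
        ≤ (2 * N) / (((N : ℝ) / 6) ^ 2 *
            (Real.log ((N : ℝ) + 1) ^ (1 + ε) / 2 ^ (1 + ε))) := by
          gcongr
          linarith
      _ = 72 * 2 ^ (1 + ε) * (1 / ((N : ℝ) * Real.log (N + 1) ^ (1 + ε))) := by
          field_simp
          ring

theorem le_sphereCurvature_logChain (ε : ℝ) {r : ℕ} (hr : 2 ≤ r) :
    ((-(Real.log (r : ℝ) ^ (1 + ε)) : ℝ) : EReal) ≤ (logChain ε).sphereCurvature 0 r := by
  obtain ⟨n, rfl⟩ := Nat.exists_eq_add_of_le' hr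
  refine le_iInf₂ fun y hy => ?_
  have hy : (logChain ε).dist 0 y = n + 2 := hy
  rw [logChain, birthDeathChain_dist_zero (logWeight_pos ε)] at hy
  subst hy
  refine le_trans ?_ (le_iSup₂_of_le (n + 1) ⟨?_, ?_⟩ le_rfl)
  · rw [EReal.coe_le_coe_iff, ← logWeight_second_difference]
    exact le_curvature_birthDeathChain (logWeight_pos ε) n
  · rw [logChain, birthDeathChain_dist_zero (logWeight_pos ε)]
  · exact (logWeight_pos ε (n + 1)).trans_eq (birthDeathChain_w_succ _).symm

end WeightedGraph

theorem theorem4p10 :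
    (∀ (V : Type*) [Countable V] (G : WeightedGraph V) (_ : G.toSimpleGraph.Connected) (x₀ : V)
      (C : ℝ) (_ : 0 < C)
      (_ : ∀ᶠ r : ℕ in atTop, ((-(C * Real.log (r : ℝ)) : ℝ) : EReal) ≤ G.sphereCurvature x₀ r),
      G.StochasticallyComplete) ∧
    (∀ ε : ℝ, 0 < ε →
      (WeightedGraph.logChain ε).toSimpleGraph.Connected ∧
      ¬ (WeightedGraph.logChain ε).StochasticallyComplete ∧
      ∀ r : ℕ, 2 ≤ r →
        ((-(Real.log (r : ℝ) ^ (1 + ε)) : ℝ) : EReal) ≤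
          (WeightedGraph.logChain ε).sphereCurvature 0 r) := by
  refine ⟨fun V _ G hG x₀ C hC h => ?_, fun ε hε => ⟨?_, ?_, fun r hr => ?_⟩⟩
  · obtain ⟨A, hA, hL⟩ := G.exists_laplacian_dist_le hG x₀ hC h
    exact G.stochasticallyComplete_of_laplacian_dist_le hG x₀ hC.le hA hL
  · exact WeightedGraph.birthDeathChain_connected (WeightedGraph.logWeight_pos ε)
  · exact WeightedGraph.not_stochasticallyComplete_birthDeathChain (WeightedGraph.logWeight_pos ε)
      (WeightedGraph.summable_add_one_div_logWeight hε)
  · exact WeightedGraph.le_sphereCurvature_logChain ε hr
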